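/- Let $A$ be a finite alphabet. Write $A^+$ for the set of nonempty finite words over $A$ and $A^\infty$ for the set of infinite words over $A$. An $\omega$-semigroup is a pair $(S_+,S_\infty)$, where $S_+$ is a semigroup and $S_\infty$ is a set, together with a mixed product $S_+\times S_\infty\to S_\infty$, $(s,x)\mapsto sx$, and an infinite product mapping each sequence $s_0,s_1,\dots$ in $S_+$ to an element $s_0s_1s_2\cdots\in S_\infty$, these products satisfying: $(st)x=s(tx)$; $s\,(s_0s_1\cdots)=s\,s_0s_1\cdots$; and the infinite product of a sequence is unchanged when consecutive finite blocks of the sequence are replaced by their products in $S_+$. It is finite if $S_+$ and $S_\infty$ are finite. With concatenation, $(A^+,A^\infty)$ is an $\omega$-semigroup. A morphism of $\omega$-semigroups is a pair of maps, one on each component, that commutes with the three products. A subset of $A^+$ (respectively $A^\infty$) is FO-definable if it is the set of words in $A^+$ (respectively $A^\infty$) that satisfy some first-order sentence over the positions of the word, in the signature consisting of the order $<$ and one unary predicate $a(x)$ for each $a\in A$. Let $X$ be $A^+$ or $A^\infty$. An FO-partition of $X$ is a finite partition of $X$ into FO-definable sets. For a map $\beta:X\to Y$ into a finite set and an FO-partition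 $\mathbf K$ of $X$, the imprint of $\mathbf K$ on $\beta$ is \[\mathcal I[\beta](\mathbf K)=\{T\subseteq Y \mid T\subseteq\beta(K)\text{ for some }K\in\mathbf K\}.\] An FO-partition $\mathbf K$ is optimal for $\beta$ if $\mathcal I[\beta](\mathbf K)\subseteq\mathcal I[\beta](\mathbf K')$ for every FO-partition $\mathbf K'$ of $X$. Optimal FO-partitions exist, and all of them have the same imprint on $\beta$; it is called the optimal imprint and denoted by $\mathcal I[\beta]$. Given an $\omega$-semigroup $(S_+,S_\infty)$, put $T^\infty=\{s_0s_1s_2\cdots\mid s_i\in T\text{ for all }i\}$ and $TU=\{sx\mid s\in T,\ x\in U\}$ for $T\subseteq S_+$ and $U\subseteq S_\infty$. For $\mathcal S\subseteq 2^{S_+}$, let $\mathrm{Sat}_\infty(\mathcal S)$ be the smallest subset $\mathcal U$ of $2^{S_\infty}$ such that 1. $T^\infty\in\mathcal U$ for every $T\in\mathcal S$; 2. $TU\in\mathcal U$ for every $T\in\mathcal S$ and $U\in\mathcal U$; 3. if $U\in\mathcal U$ and $V\subseteq U$, then $V\in\mathcal U$. **Proposition.** Let $\alpha:(A^+,A^\infty)\to(S_+,S_\infty)$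 be a morphism into a finite $\omega$-semigroup, with components $\alpha_+:A^+\to S_+$ and $\alpha_\infty:A^\infty\to S_\infty$. Then \[\mathcal I[\alpha_\infty]=\mathrm{Sat}_\infty(\mathcal I[\alpha_+]).\] -/

import Mathlib

universe u v w z

namespace FOImprint

/-! ### Omega-semigroups -/

/-- `segProd f i m` is the product `f i * f (i + 1) * ⋯ * f (i + m)` of `m + 1` consecutive terms. -/
def segProd {S : Type u} [Semigroup S] (f : ℕ → S) (i : ℕ) : ℕ → S
  | 0 => f i
  | m + 1 => segProd f i m * f (i + (m + 1))

/-- The sequence `s, f 0, f 1, …`. -/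
def seqCons {S : Type u} (s : S) (f : ℕ → S) : ℕ → S
  | 0 => s
  | n + 1 => f n

/-- An omega-semigroup `(S, T)`: a semigroup `S`, a set `T`, a mixed product `S × T → T` and an
infinite product from sequences of elements of `S` to `T`, subject to all forms of associativity.
In the last axiom, the sequence `f` is cut into the consecutive finite blocks
`f (k n), …, f (k (n + 1) - 1)`, for `0 = k 0 < k 1 < k 2 < ⋯`. -/
class OmegaSemigroup (S : Type u) (T : Type v) [Semigroup S] where
  mixed : S → T → T
  infProd : (ℕ → S) → T
  mul_mixed : ∀ (s t : S) (x : T), mixed (s * t) x = mixed s (mixed t x)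
  mixed_infProd : ∀ (s : S) (f : ℕ → S), mixed s (infProd f) = infProd (seqCons s f)
  infProd_blocks : ∀ (f : ℕ → S) (k : ℕ → ℕ), StrictMono k → k 0 = 0 →
    infProd (fun n => segProd f (k n) (k (n + 1) - k n - 1)) = infProd f

/-- Morphisms of omega-semigroups `(S, T) → (S', T')`. -/
structure OmegaHom (S : Type u) (T : Type v) (S' : Type w) (T' : Type z)
    [Semigroup S] [OmegaSemigroup S T] [Semigroup S'] [OmegaSemigroup S' T'] where
  /-- the component on finite words, a semigroup morphism -/
  fin : S →ₙ* S'
  /-- the component on infinite words -/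
  inf : T → T'
  map_mixed : ∀ (s : S) (x : T),
    inf (OmegaSemigroup.mixed s x) = OmegaSemigroup.mixed (fin s) (inf x)
  map_infProd : ∀ f : ℕ → S,
    inf (OmegaSemigroup.infProd f) = OmegaSemigroup.infProd (fun n => fin (f n))

/-! ### Finite and infinite words -/

/-- Nonempty finite words over `A`. -/
abbrev Word (A : Type u) : Type u := FreeSemigroup A

/-- Infinite words over `A`. -/
abbrev OmegaWord (A : Type u) : Type u := ℕ → A

/-- The list of letters of a nonempty finite word. -/
def letters {A : Type u} (w : Word A) : List A := w.head :: w.tail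

/-- The letter at a position of a nonempty finite word. -/
def letterAt {A : Type u} (w : Word A) (p : Fin (letters w).length) : A := (letters w).get p

theorem letters_mul {A : Type u} (v w : Word A) : letters (v * w) = letters v ++ letters w := rfl

theorem letters_length_pos {A : Type u} (w : Word A) : 0 < (letters w).length :=
  Nat.succ_pos _

theorem lt_length_segProd {A : Type u} (f : ℕ → Word A) (i m : ℕ) :
    m < (letters (segProd f i m)).length := by
  induction m with
  | zero => exact letters_length_pos _
  | succ m ih =>
    have h := letters_length_pos (f (i + (m + 1)))
    simp only [segProd, letters_mul, List.length_append]
    omega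

/-- The concatenation of a finite word and an infinite word. -/
def concat {A : Type u} (w : Word A) (x : OmegaWord A) : OmegaWord A := fun p =>
  if h : p < (letters w).length then (letters w)[p] else x (p - (letters w).length)

/-- The infinite concatenation `f 0 · f 1 · f 2 ⋯` of nonempty finite words: its letter at position
`p` is the letter at position `p` of `f 0 ⋯ f p`, a word of length greater than `p`. -/
def infConcat {A : Type u} (f : ℕ → Word A) : OmegaWord A := fun p =>
  (letters (segProd f 0 p))[p]'(lt_length_segProd f 0 p)

theorem segProd_prefix {A : Type u} (f : ℕ → Word A) (i : ℕ) {m n : ℕ} (h : m ≤ n) :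
    letters (segProd f i m) <+: letters (segProd f i n) := by
  induction n, h using Nat.le_induction with
  | base => exact List.prefix_rfl
  | succ n _ ih => exact ih.trans (List.prefix_append _ _)

theorem infConcat_eq {A : Type u} (f : ℕ → Word A) (p q : ℕ)
    (h : p < (letters (segProd f 0 q)).length) :
    infConcat f p = (letters (segProd f 0 q))[p] := by
  rcases le_total p q with hpq | hpq
  · exact (segProd_prefix f 0 hpq).getElem _
  · exact ((segProd_prefix f 0 hpq).getElem h).symm

theorem segProd_mul {S : Type u} [Semigroup S] (f : ℕ → S) (i m n : ℕ) :
    segProd f i m * segProd f (i + m + 1) n = segProd f i (m + n + 1) := by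
  induction n with
  | zero => rfl
  | succ n ih =>
    have e : i + m + 1 + (n + 1) = i + (m + (n + 1) + 1) := by omega
    simp only [segProd]
    rw [← mul_assoc, ih, e]
    rfl

theorem segProd_cons {S : Type u} [Semigroup S] (s : S) (f : ℕ → S) (m : ℕ) :
    segProd (seqCons s f) 0 (m + 1) = s * segProd f 0 m := by
  induction m with
  | zero => rfl
  | succ m ih =>
    rw [segProd, ih, segProd, ← mul_assoc]
    simp [seqCons]

theorem segProd_blocks {S : Type u} [Semigroup S] (f : ℕ → S) (k : ℕ → ℕ) (hk : StrictMono k)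
    (h0 : k 0 = 0) (m : ℕ) :
    segProd (fun n => segProd f (k n) (k (n + 1) - k n - 1)) 0 m
      = segProd f 0 (k (m + 1) - 1) := by
  induction m with
  | zero => simp [segProd, h0]
  | succ m ih =>
    have h1 : k (m + 1) < k (m + 1 + 1) := hk (Nat.lt_succ_self _)
    have h2 : 0 < k (m + 1) := by rw [← h0]; exact hk (Nat.succ_pos _)
    rw [segProd, ih]
    have h3 := segProd_mul f 0 (k (m + 1) - 1) (k (m + 1 + 1) - k (m + 1) - 1)
    have e1 : 0 + (k (m + 1) - 1) + 1 = k (m + 1) := by omega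
    have e2 : k (m + 1) - 1 + (k (m + 1 + 1) - k (m + 1) - 1) + 1 = k (m + 1 + 1) - 1 := by omega
    rw [e1, e2] at h3
    simpa using h3

/-- The omega-semigroup of nonempty finite words and infinite words over `A`. -/
instance instOmegaSemigroupWord (A : Type u) : OmegaSemigroup (Word A) (OmegaWord A) where
  mixed := concat
  infProd := infConcat
  mul_mixed v w x := by
    funext p
    simp only [concat, letters_mul, List.length_append, List.getElem_append]
    by_cases h1 : p < (letters v).length
    · simp [h1, Nat.lt_add_right]
    · by_cases h2 : p - (letters v).length < (letters w).length
      · have h3 : p < (letters v).length + (letters w).length := by omega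
        simp [h1, h2, h3]
      · have h3 : ¬ p < (letters v).length + (letters w).length := by omega
        simp [h1, h2, h3, Nat.sub_sub]
  mixed_infProd w f := by
    funext p
    have hl : p < (letters w ++ letters (segProd f 0 p)).length := by
      have := lt_length_segProd f 0 p
      rw [List.length_append]; omega
    have e : letters (segProd (seqCons w f) 0 (p + 1)) = letters w ++ letters (segProd f 0 p) := by
      rw [segProd_cons, letters_mul]
    rw [infConcat_eq (seqCons w f) p (p + 1) (by rw [e]; exact hl)]
    simp only [e, concat, List.getElem_append]
    by_cases h1 : p < (letters w).length
    · simp [h1]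
    · simp only [h1, dite_false]
      exact infConcat_eq f _ _ _
  infProd_blocks f k hk h0 := by
    funext p
    have e := segProd_blocks f k hk h0 p
    have hl := lt_length_segProd (fun n => segProd f (k n) (k (n + 1) - k n - 1)) 0 p
    rw [infConcat_eq f p (k (p + 1) - 1) (by rw [← e]; exact hl)]
    simp only [infConcat, e]

/-! ### First-order logic over words -/

/-- The relation symbols of `FO(<)` over `A`: a unary one for each letter, and a binary one. -/
inductive WordRel (A : Type u) : ℕ → Type u
  | letter (a : A) : WordRel A 1
  | lt : WordRel A 2

/-- The first-order signature of words over `A`. -/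
def wordLang (A : Type u) : FirstOrder.Language.{0, u} where
  Functions _ := Empty
  Relations := WordRel A

/-- The logical structure of a word with ordered set of positions `P` and labelling `ℓ`. -/
abbrev wordStructure {A : Type u} {P : Type} [LT P] (ℓ : P → A) : (wordLang A).Structure P where
  funMap := fun f => Empty.elim f
  RelMap := fun r x => match r, x with
    | WordRel.letter a, x => ℓ (x 0) = a
    | WordRel.lt, x => x 0 < x 1

/-- The word with labelling `ℓ` satisfies the sentence `φ` of `FO(<)`. -/
def Satisfies {A : Type u} {P : Type} [LT P] (ℓ : P → A) (φ : (wordLang A).Sentence) : Prop :=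
  letI := wordStructure ℓ
  φ.Realize P

/-- The first-order definable languages of nonempty finite words. -/
def foWord (A : Type u) : Set (Set (Word A)) :=
  {L | ∃ φ : (wordLang A).Sentence, L = {w | Satisfies (letterAt w) φ}}

/-- The first-order definable languages of infinite words. -/
def foOmega (A : Type u) : Set (Set (OmegaWord A)) :=
  {L | ∃ φ : (wordLang A).Sentence, L = {x | Satisfies x φ}}

/-! ### Partitions, imprints and optimal imprints

Here `X` is the set of all words under consideration, `C` a class of subsets of `X` and `α` a map
from `X` to `Y`. -/

/-- `K` is a finite partition of `X` into languages of `C`. -/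
def IsClassPartition {X : Type u} (C : Set (Set X)) (K : Set (Set X)) : Prop :=
  K.Finite ∧ Setoid.IsPartition K ∧ K ⊆ C

/-- The imprint of `K` on `α`. -/
def imprint {X : Type u} {Y : Type v} (α : X → Y) (K : Set (Set X)) : Set (Set Y) :=
  {T | ∃ L ∈ K, T ⊆ α '' L}

/-- `K` is an optimal `C`-partition for `α`. -/
def IsOptimal {X : Type u} {Y : Type v} (C : Set (Set X)) (α : X → Y) (K : Set (Set X)) : Prop :=
  IsClassPartition C K ∧ ∀ K', IsClassPartition C K' → imprint α K ⊆ imprint α K'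

/-- The optimal imprint with respect to `C` on `α`, that is, the imprint on `α` of any optimal
`C`-partition for `α`. -/
def optimalImprint {X : Type u} {Y : Type v} (C : Set (Set X)) (α : X → Y) : Set (Set Y) :=
  {T | ∃ K, IsOptimal C α K ∧ T ∈ imprint α K}

theorem optimalImprint_eq {X : Type u} {Y : Type v} {C : Set (Set X)} {α : X → Y} {K : Set (Set X)}
    (hK : IsOptimal C α K) : optimalImprint C α = imprint α K := by
  ext T
  constructor
  · rintro ⟨K', hK', hT⟩
    exact hK'.2 K hK.1 hT
  · exact fun hT => ⟨K, hK, hT⟩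

theorem exists_isOptimal {X : Type u} {Y : Type v} [Finite Y] {C : Set (Set X)}
    (huniv : Set.univ ∈ C) (hinter : ∀ L ∈ C, ∀ L' ∈ C, L ∩ L' ∈ C) (α : X → Y) :
    ∃ K, IsOptimal C α K := by
  have hne : {I | ∃ K, IsClassPartition C K ∧ I = imprint α K}.Nonempty := by
    rcases isEmpty_or_nonempty X with hX | hX
    · exact ⟨_, ∅, ⟨Set.finite_empty, ⟨Set.notMem_empty _, fun a => hX.elim a⟩,
        Set.empty_subset _⟩, rfl⟩
    · refine ⟨_, {Set.univ}, ⟨Set.finite_singleton _, ⟨?_, fun a => ?_⟩, ?_⟩, rfl⟩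
      · simpa using (Set.univ_nonempty.ne_empty (α := X)).symm
      · exact ⟨Set.univ, ⟨rfl, trivial⟩, fun L hL => hL.1⟩
      · simpa using huniv
  obtain ⟨I, hI⟩ := (Set.toFinite {I | ∃ K, IsClassPartition C K ∧ I = imprint α K}).exists_minimal
    hne
  obtain ⟨K, hK, rfl⟩ := hI.1
  refine ⟨K, hK, fun K' hK' => ?_⟩
  have hM : IsClassPartition C {L | L.Nonempty ∧ ∃ L₁ ∈ K, ∃ L₂ ∈ K', L = L₁ ∩ L₂} := by
    refine ⟨?_, ⟨fun h => by simpa using h.1, fun a => ?_⟩, ?_⟩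
    · refine (hK.1.image2 (fun L₁ L₂ => L₁ ∩ L₂) hK'.1).subset ?_
      rintro L ⟨-, L₁, h₁, L₂, h₂, rfl⟩
      exact ⟨L₁, h₁, L₂, h₂, rfl⟩
    · obtain ⟨L₁, ⟨h₁, a₁⟩, u₁⟩ := hK.2.1.2 a
      obtain ⟨L₂, ⟨h₂, a₂⟩, u₂⟩ := hK'.2.1.2 a
      refine ⟨L₁ ∩ L₂, ⟨⟨⟨a, a₁, a₂⟩, L₁, h₁, L₂, h₂, rfl⟩, a₁, a₂⟩, ?_⟩
      rintro L ⟨⟨-, M₁, m₁, M₂, m₂, rfl⟩, b₁, b₂⟩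
      rw [u₁ M₁ ⟨m₁, b₁⟩, u₂ M₂ ⟨m₂, b₂⟩]
    · rintro L ⟨-, L₁, h₁, L₂, h₂, rfl⟩
      exact hinter _ (hK.2.2 h₁) _ (hK'.2.2 h₂)
  have hle : imprint α {L | L.Nonempty ∧ ∃ L₁ ∈ K, ∃ L₂ ∈ K', L = L₁ ∩ L₂} ⊆ imprint α K := by
    rintro T ⟨L, ⟨-, L₁, h₁, L₂, h₂, rfl⟩, hT⟩
    exact ⟨L₁, h₁, hT.trans (Set.image_mono Set.inter_subset_left)⟩
  intro T hT
  obtain ⟨L, ⟨-, L₁, h₁, L₂, h₂, rfl⟩, hT'⟩ := hI.2 ⟨_, hM, rfl⟩ hle hT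
  exact ⟨L₂, h₂, hT'.trans (Set.image_mono Set.inter_subset_right)⟩

/-- First-order optimal partitions of finite words exist. -/
theorem exists_isOptimal_foWord {A : Type u} {Y : Type v} [Finite Y] (α : Word A → Y) :
    ∃ K, IsOptimal (foWord A) α K := by
  have huniv : Set.univ ∈ foWord A := by
    refine ⟨⊤, ?_⟩
    ext w
    simp [Satisfies, FirstOrder.Language.Sentence.Realize]
  refine exists_isOptimal huniv ?_ α
  rintro _ ⟨φ, rfl⟩ _ ⟨ψ, rfl⟩
  refine ⟨φ ⊓ ψ, ?_⟩
  ext w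
  simp [Satisfies, FirstOrder.Language.Sentence.Realize]

/-- First-order optimal partitions of infinite words exist. -/
theorem exists_isOptimal_foOmega {A : Type u} {Y : Type v} [Finite Y] (α : OmegaWord A → Y) :
    ∃ K, IsOptimal (foOmega A) α K := by
  have huniv : Set.univ ∈ foOmega A := by
    refine ⟨⊤, ?_⟩
    ext w
    simp [Satisfies, FirstOrder.Language.Sentence.Realize]
  refine exists_isOptimal huniv ?_ α
  rintro _ ⟨φ, rfl⟩ _ ⟨ψ, rfl⟩
  refine ⟨φ ⊓ ψ, ?_⟩
  ext w
  simp [Satisfies, FirstOrder.Language.Sentence.Realize]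

/-! ### Saturation -/

/-- The mixed product of subsets: all `s x` with `s ∈ R` and `x ∈ U`. -/
def setMixed {S : Type u} {T : Type v} [Semigroup S] [OmegaSemigroup S T] (R : Set S) (U : Set T) :
    Set T :=
  {y | ∃ s ∈ R, ∃ x ∈ U, y = OmegaSemigroup.mixed s x}

/-- The infinite power of a subset `R` of `S`: all `s₀ s₁ s₂ ⋯` where each `sₙ` is in `R`. -/
def setInfPow {S : Type u} (T : Type v) [Semigroup S] [OmegaSemigroup S T] (R : Set S) : Set T :=
  {y | ∃ f : ℕ → S, (∀ n, f n ∈ R) ∧ y = OmegaSemigroup.infProd f}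

/-- `𝒰` contains the infinite powers of the members of `𝒮`, is closed under left multiplication by
members of `𝒮`, and is closed under downset. -/
def IsSaturated {S : Type u} {T : Type v} [Semigroup S] [OmegaSemigroup S T] (𝒮 : Set (Set S))
    (𝒰 : Set (Set T)) : Prop :=
  (∀ R ∈ 𝒮, setInfPow T R ∈ 𝒰) ∧
  (∀ R ∈ 𝒮, ∀ U ∈ 𝒰, setMixed R U ∈ 𝒰) ∧
  (∀ U ∈ 𝒰, ∀ V, V ⊆ U → V ∈ 𝒰)

/-- The smallest saturated subset of `Set T`. -/
def satInf {S : Type u} (T : Type v) [Semigroup S] [OmegaSemigroup S T] (𝒮 : Set (Set S)) :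
    Set (Set T) :=
  ⋂₀ {𝒰 | IsSaturated 𝒮 𝒰}

theorem satInf_isLeast {S : Type u} (T : Type v) [Semigroup S] [OmegaSemigroup S T]
    (𝒮 : Set (Set S)) : IsLeast {𝒰 | IsSaturated 𝒮 𝒰} (satInf T 𝒮) := by
  refine ⟨⟨fun R hR 𝒰 h => h.1 R hR, fun R hR U hU 𝒰 h => h.2.1 R hR U (hU 𝒰 h),
    fun U hU V hV 𝒰 h => h.2.2 U (hU 𝒰 h) V hV⟩, fun 𝒰 h => Set.sInter_subset_of_mem h⟩

end FOImprint

/-!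
Call two words equivalent of rank `k` if Duplicator wins the `k`-round Ehrenfeucht–Fraïssé game on
them. By Hintikka's theorem the partitions into classes of rank `k` are first-order, and they
eventually refine every first-order partition. Hence `T` is in the optimal imprint if and only if,
for every `k`, it lies in the image of a single class of rank `k`.

Duplicator can play block by block, so equivalence of rank `k` is compatible with the three
products. This makes the optimal imprint on infinite words saturated.

Conversely, Ramsey's argument applied to the classes of the factors of an infinite word `x` gives a
position `a`, and a word `v`, such that factors equivalent to `v` lead from `a` to arbitrarily late
positions that merge with `a`. Splitting `x` at such positions shows `x ∈ [u][v]^∞`, where `u` is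
the prefix of `x` before `a` and the brackets denote classes of rank `k`. That `a` has this property
is visible to the game within finitely many rounds: one for the first position, one for `a`, and
three for the quantifiers in the property. Hence the whole class of `x` of rank `k + 5` is contained
in `[u][v]^∞`.
-/

namespace FOImprint

open Set

/-! ### Ehrenfeucht–Fraïssé games on labelled orders -/

section BackForth

variable {A P P' P'' : Type*} [LT P] [LT P'] [LT P'']
  {ℓ : P → A} {ℓ' : P' → A} {ℓ'' : P'' → A} {k m : ℕ}

/-- The relation `R` preserves and reflects labels and strict order. Distinct elements of an
arbitrary order need not be separated by `R`; between linear orders, `R` is the graph of a partial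
isomorphism. -/
structure IsPartialIso (ℓ : P → A) (ℓ' : P' → A) (R : SetRel P P') : Prop where
  label_eq : ∀ ⦃p p'⦄, (p, p') ∈ R → ℓ p = ℓ' p'
  lt_iff_lt : ∀ ⦃p p' q q'⦄, (p, p') ∈ R → (q, q') ∈ R → (p < q ↔ p' < q')

/-- Duplicator wins the `k`-round Ehrenfeucht–Fraïssé game between two labelled orders from the
position in which the pairs of `R` have been chosen. -/
def BackForth (ℓ : P → A) (ℓ' : P' → A) : ℕ → SetRel P P' → Prop
  | 0, R => IsPartialIso ℓ ℓ' R
  | k + 1, R => IsPartialIso ℓ ℓ' R ∧ (∀ p, ∃ p', BackForth ℓ ℓ' k (insert (p, p') R)) ∧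
      ∀ p', ∃ p, BackForth ℓ ℓ' k (insert (p, p') R)

theorem IsPartialIso.mono {R R' : SetRel P P'} (h : IsPartialIso ℓ ℓ' R') (hR : R ⊆ R') :
    IsPartialIso ℓ ℓ' R :=
  ⟨fun _ _ hp => h.label_eq (hR hp), fun _ _ _ _ hp hq => h.lt_iff_lt (hR hp) (hR hq)⟩

theorem IsPartialIso.inv {R : SetRel P P'} (h : IsPartialIso ℓ ℓ' R) : IsPartialIso ℓ' ℓ R.inv :=
  ⟨fun _ _ hp => (h.label_eq hp).symm, fun _ _ _ _ hp hq => (h.lt_iff_lt hp hq).symm⟩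

theorem IsPartialIso.comp {R : SetRel P P'} {R' : SetRel P' P''} (h : IsPartialIso ℓ ℓ' R)
    (h' : IsPartialIso ℓ' ℓ'' R') : IsPartialIso ℓ ℓ'' (R.comp R') where
  label_eq := by
    rintro p p'' ⟨p', hp, hp'⟩
    exact (h.label_eq hp).trans (h'.label_eq hp')
  lt_iff_lt := by
    rintro p p'' q q'' ⟨p', hp, hp'⟩ ⟨q', hq, hq'⟩
    exact (h.lt_iff_lt hp hq).trans (h'.lt_iff_lt hp' hq')

theorem IsPartialIso.domRestrict {R : SetRel P P'} (h : IsPartialIso ℓ ℓ' R) (s : Set P)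
    (s' : Set P') : IsPartialIso (s.domRestrict ℓ) (s'.domRestrict ℓ') (Prod.map (↑) (↑) ⁻¹' R) :=
  ⟨fun _ _ hp => h.label_eq hp, fun _ _ _ _ hp hq => h.lt_iff_lt hp hq⟩

theorem BackForth.isPartialIso {R : SetRel P P'} (h : BackForth ℓ ℓ' k R) :
    IsPartialIso ℓ ℓ' R := by
  cases k with
  | zero => exact h
  | succ k => exact h.1

theorem BackForth.mono {R R' : SetRel P P'} (h : BackForth ℓ ℓ' k R') (hR : R ⊆ R') :
    BackForth ℓ ℓ' k R := by
  induction k generalizing R R' with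
  | zero => exact IsPartialIso.mono h hR
  | succ k ih =>
    exact ⟨h.1.mono hR, fun p => (h.2.1 p).imp fun _ hp => ih hp (insert_subset_insert hR),
      fun p' => (h.2.2 p').imp fun _ hp => ih hp (insert_subset_insert hR)⟩

theorem BackForth.of_le {R : SetRel P P'} (hkm : k ≤ m) (h : BackForth ℓ ℓ' m R) :
    BackForth ℓ ℓ' k R := by
  induction k generalizing m R with
  | zero => exact h.isPartialIso
  | succ k ih =>
    obtain ⟨m, rfl⟩ := Nat.exists_eq_succ_of_ne_zero (Nat.ne_zero_of_lt hkm)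
    have hkm' := Nat.le_of_succ_le_succ hkm
    exact ⟨h.1, fun p => (h.2.1 p).imp fun _ hp => ih hkm' hp,
      fun p' => (h.2.2 p').imp fun _ hp => ih hkm' hp⟩

theorem BackForth.symm {R : SetRel P P'} (h : BackForth ℓ ℓ' k R) : BackForth ℓ' ℓ k R.inv := by
  induction k generalizing R with
  | zero => exact IsPartialIso.inv h
  | succ k ih =>
    have insert_inv (p p') : insert (p', p) R.inv ⊆ SetRel.inv (insert (p, p') R) :=
      insert_subset (Or.inl rfl) fun _ => Or.inr
    exact ⟨h.1.inv, fun p' => (h.2.2 p').imp fun p hp => (ih hp).mono (insert_inv p p'),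
      fun p => (h.2.1 p).imp fun p' hp => (ih hp).mono (insert_inv p p')⟩

theorem BackForth.trans {R : SetRel P P'} {R' : SetRel P' P''} (h : BackForth ℓ ℓ' k R)
    (h' : BackForth ℓ' ℓ'' k R') : BackForth ℓ ℓ'' k (R.comp R') := by
  induction k generalizing R R' with
  | zero => exact IsPartialIso.comp h h'
  | succ k ih =>
    have insert_comp (p p' p'') : insert (p, p'') (R.comp R') ⊆
        SetRel.comp (insert (p, p') R) (insert (p', p'') R') :=
      insert_subset ⟨p', Or.inl rfl, Or.inl rfl⟩
        (SetRel.comp_subset_comp (subset_insert _ _) (subset_insert _ _))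
    refine ⟨h.1.comp h'.1, fun p => ?_, fun p'' => ?_⟩
    · obtain ⟨p', hp⟩ := h.2.1 p
      obtain ⟨p'', hp'⟩ := h'.2.1 p'
      exact ⟨p'', (ih hp hp').mono (insert_comp _ _ _)⟩
    · obtain ⟨p', hp'⟩ := h'.2.2 p''
      obtain ⟨p, hp⟩ := h.2.2 p'
      exact ⟨p, (ih hp hp').mono (insert_comp _ _ _)⟩

/-- Subsets that the chosen pairs force to correspond to each other can be played on separately. -/
theorem BackForth.domRestrict {R : SetRel P P'} {s : Set P} {s' : Set P'}
    (hs : ∀ p p', IsPartialIso ℓ ℓ' (insert (p, p') R) → (p ∈ s ↔ p' ∈ s'))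
    (h : BackForth ℓ ℓ' k R) :
    BackForth (s.domRestrict ℓ) (s'.domRestrict ℓ') k (Prod.map (↑) (↑) ⁻¹' R) := by
  induction k generalizing R with
  | zero => exact IsPartialIso.domRestrict h s s'
  | succ k ih =>
    have hs_insert (q q') : ∀ p p', IsPartialIso ℓ ℓ' (insert (p, p') (insert (q, q') R)) →
        (p ∈ s ↔ p' ∈ s') :=
      fun p p' hp => hs p p' (hp.mono (insert_subset_insert (subset_insert _ _)))
    have insert_preimage (q : s) (q' : s') :
        insert (q, q') (Prod.map (↑) (↑) ⁻¹' R : SetRel s s') ⊆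
          Prod.map (↑) (↑) ⁻¹' (insert (↑q, ↑q') R) :=
      insert_subset (Or.inl rfl) fun _ => Or.inr
    refine ⟨h.1.domRestrict s s', fun q => ?_, fun q' => ?_⟩
    · obtain ⟨q', hq⟩ := h.2.1 q
      have hq' : q' ∈ s' := (hs _ _ hq.isPartialIso).1 q.2
      exact ⟨⟨q', hq'⟩, (ih (hs_insert q q') hq).mono (insert_preimage q ⟨q', hq'⟩)⟩
    · obtain ⟨q, hq⟩ := h.2.2 q'
      have hq' : q ∈ s := (hs _ _ hq.isPartialIso).2 q'.2
      exact ⟨⟨q, hq'⟩, (ih (hs_insert q q') hq).mono (insert_preimage ⟨q, hq'⟩ q')⟩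

end BackForth

section OrderIso

variable {A P P' : Type*} [Preorder P] [Preorder P'] {ℓ : P → A} {ℓ' : P' → A} {R : SetRel P P'}

theorem IsPartialIso.of_orderIso (e : P ≃o P') (he : ∀ p, ℓ' (e p) = ℓ p)
    (hR : ∀ p p', (p, p') ∈ R → e p = p') : IsPartialIso ℓ ℓ' R where
  label_eq p p' hp := by rw [← hR p p' hp, he]
  lt_iff_lt p p' q q' hp hq := by rw [← hR p p' hp, ← hR q q' hq, e.lt_iff_lt]

theorem BackForth.of_orderIso {k : ℕ} (e : P ≃o P') (he : ∀ p, ℓ' (e p) = ℓ p)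
    (hR : ∀ p p', (p, p') ∈ R → e p = p') : BackForth ℓ ℓ' k R := by
  induction k generalizing R with
  | zero => exact .of_orderIso e he hR
  | succ k ih =>
    have extend (p) : BackForth ℓ ℓ' k (insert (p, e p) R) := by
      refine ih ?_
      rintro q q' (hq | hq)
      · rw [(Prod.mk.inj hq).1, (Prod.mk.inj hq).2]
      · exact hR q q' hq
    exact ⟨.of_orderIso e he hR, fun p => ⟨e p, extend p⟩,
      fun p' => ⟨e.symm p', by simpa using extend (e.symm p')⟩⟩

end OrderIso

/-- Spoiler's minimum can only be answered by the minimum, at the cost of one more round. -/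
theorem BackForth.insert_bot {A P P' : Type*} [PartialOrder P] [OrderBot P] [PartialOrder P']
    [OrderBot P'] {ℓ : P → A} {ℓ' : P' → A} {k : ℕ} {R : SetRel P P'}
    (h : BackForth ℓ ℓ' (k + 2) R) : BackForth ℓ ℓ' (k + 1) (insert (⊥, ⊥) R) := by
  obtain ⟨p', hp'⟩ := h.2.1 ⊥
  obtain ⟨p, hp⟩ := hp'.2.2 ⊥
  have hlt : p < ⊥ ↔ ⊥ < p' := hp.isPartialIso.lt_iff_lt (Or.inl rfl) (Or.inr (Or.inl rfl))
  obtain rfl : p' = ⊥ := not_bot_lt_iff.1 (hlt.not.1 not_lt_bot)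
  exact hp'

/-- The sets `s i` cover `P`, and `s i` lies entirely below `s j` when `i < j`. -/
structure IsOrderedCover {ι P : Type*} [LT ι] [LT P] (s : ι → Set P) : Prop where
  exists_mem : ∀ p, ∃ i, p ∈ s i
  lt_of_lt : ∀ ⦃i j p q⦄, i < j → p ∈ s i → q ∈ s j → p < q

section OrderedCover

variable {A ι P P' : Type*} [LinearOrder ι] [Preorder P] [Preorder P'] {ℓ : P → A} {ℓ' : P' → A}
  {s : ι → Set P} {s' : ι → Set P'} {k : ℕ} {R : SetRel P P'}

theorem IsOrderedCover.eq_of_mem (hs : IsOrderedCover s) {i j : ι} {p : P} (hi : p ∈ s i)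
    (hj : p ∈ s j) : i = j :=
  le_antisymm (not_lt.1 fun hji => lt_irrefl p (hs.lt_of_lt hji hj hi))
    (not_lt.1 fun hij => lt_irrefl p (hs.lt_of_lt hij hi hj))

theorem IsPartialIso.of_isOrderedCover (hs : IsOrderedCover s) (hs' : IsOrderedCover s')
    (hR : ∀ p p', (p, p') ∈ R → ∃ i, p ∈ s i ∧ p' ∈ s' i)
    (h : ∀ i, IsPartialIso ((s i).domRestrict ℓ) ((s' i).domRestrict ℓ') (Prod.map (↑) (↑) ⁻¹' R)) :
    IsPartialIso ℓ ℓ' R where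
  label_eq p p' hp := by
    obtain ⟨i, hi, hi'⟩ := hR p p' hp
    exact (h i).label_eq (p := ⟨p, hi⟩) (p' := ⟨p', hi'⟩) hp
  lt_iff_lt p p' q q' hp hq := by
    obtain ⟨i, hi, hi'⟩ := hR p p' hp
    obtain ⟨j, hj, hj'⟩ := hR q q' hq
    rcases lt_trichotomy i j with hij | rfl | hji
    · exact iff_of_true (hs.lt_of_lt hij hi hj) (hs'.lt_of_lt hij hi' hj')
    · exact (h i).lt_iff_lt (p := ⟨p, hi⟩) (p' := ⟨p', hi'⟩) (q := ⟨q, hj⟩) (q' := ⟨q', hj'⟩) hp hq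
    · exact iff_of_false (hs.lt_of_lt hji hj hi).not_gt (hs'.lt_of_lt hji hj' hi').not_gt

theorem BackForth.domRestrict_insert (hs : IsOrderedCover s) {i : ι} (p : s i) (p' : s' i)
    (h : ∀ j, BackForth ((s j).domRestrict ℓ) ((s' j).domRestrict ℓ') k (Prod.map (↑) (↑) ⁻¹' R))
    (hi : BackForth ((s i).domRestrict ℓ) ((s' i).domRestrict ℓ') k
      (insert (p, p') (Prod.map (↑) (↑) ⁻¹' R))) (j : ι) :
    BackForth ((s j).domRestrict ℓ) ((s' j).domRestrict ℓ') k
      (Prod.map (↑) (↑) ⁻¹' insert (↑p, ↑p') R) := by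
  rcases eq_or_ne j i with rfl | hji
  · refine hi.mono ?_
    rintro ⟨q, q'⟩ (hq | hq)
    · exact Or.inl (Prod.ext (Subtype.ext (Prod.mk.inj hq).1) (Subtype.ext (Prod.mk.inj hq).2))
    · exact Or.inr hq
  · refine (h j).mono ?_
    rintro ⟨q, q'⟩ (hq | hq)
    · exact absurd (hs.eq_of_mem q.2 ((Prod.mk.inj hq).1 ▸ p.2)) hji
    · exact hq

/-- Duplicator answers each move inside the block in which Spoiler plays. -/
theorem BackForth.of_isOrderedCover (hs : IsOrderedCover s) (hs' : IsOrderedCover s')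
    (hR : ∀ p p', (p, p') ∈ R → ∃ i, p ∈ s i ∧ p' ∈ s' i)
    (h : ∀ i, BackForth ((s i).domRestrict ℓ) ((s' i).domRestrict ℓ') k (Prod.map (↑) (↑) ⁻¹' R)) :
    BackForth ℓ ℓ' k R := by
  have hiso : IsPartialIso ℓ ℓ' R := .of_isOrderedCover hs hs' hR fun i => (h i).isPartialIso
  induction k generalizing R with
  | zero => exact hiso
  | succ k ih =>
    have answer {i : ι} (p : s i) (p' : s' i)
        (hi : BackForth ((s i).domRestrict ℓ) ((s' i).domRestrict ℓ') k
          (insert (p, p') (Prod.map (↑) (↑) ⁻¹' R))) : BackForth ℓ ℓ' k (insert (↑p, ↑p') R) := by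
      have hR_insert : ∀ q q', (q, q') ∈ insert ((p : P), (p' : P')) R →
          ∃ i, q ∈ s i ∧ q' ∈ s' i := by
        rintro q q' (hq | hq)
        · exact ⟨i, (Prod.mk.inj hq).1 ▸ p.2, (Prod.mk.inj hq).2 ▸ p'.2⟩
        · exact hR q q' hq
      have h_insert := domRestrict_insert hs p p' (fun j => (h j).of_le k.le_succ) hi
      exact ih hR_insert h_insert
        (.of_isOrderedCover hs hs' hR_insert fun j => (h_insert j).isPartialIso)
    refine ⟨hiso, fun p => ?_, fun p' => ?_⟩
    · obtain ⟨i, hi⟩ := hs.exists_mem p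
      obtain ⟨p', hp'⟩ := (h i).2.1 ⟨p, hi⟩
      exact ⟨p', answer ⟨p, hi⟩ p' hp'⟩
    · obtain ⟨i, hi⟩ := hs'.exists_mem p'
      obtain ⟨p, hp⟩ := (h i).2.2 ⟨p', hi⟩
      exact ⟨p, answer p ⟨p', hi⟩ hp⟩

end OrderedCover

/-- Equivalence of rank `k`: Duplicator wins the `k`-round Ehrenfeucht–Fraïssé game. -/
def RankEquiv {A P P' : Type*} [LT P] [LT P'] (k : ℕ) (ℓ : P → A) (ℓ' : P' → A) : Prop :=
  BackForth ℓ ℓ' k ∅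

section RankEquiv

variable {A P P' P'' : Type*} {k m : ℕ}

theorem RankEquiv.symm [LT P] [LT P'] {ℓ : P → A} {ℓ' : P' → A} (h : RankEquiv k ℓ ℓ') :
    RankEquiv k ℓ' ℓ :=
  BackForth.symm h

theorem RankEquiv.trans [LT P] [LT P'] [LT P''] {ℓ : P → A} {ℓ' : P' → A} {ℓ'' : P'' → A}
    (h : RankEquiv k ℓ ℓ') (h' : RankEquiv k ℓ' ℓ'') : RankEquiv k ℓ ℓ'' :=
  (BackForth.trans h h').mono (empty_subset _)

theorem RankEquiv.of_le [LT P] [LT P'] {ℓ : P → A} {ℓ' : P' → A} (hkm : k ≤ m)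
    (h : RankEquiv m ℓ ℓ') : RankEquiv k ℓ ℓ' :=
  BackForth.of_le hkm h

theorem RankEquiv.refl [Preorder P] (k : ℕ) (ℓ : P → A) : RankEquiv k ℓ ℓ :=
  .of_orderIso (.refl P) (fun _ => rfl) (by simp)

theorem rankEquiv_domRestrict_of_range_eq [LinearOrder P] [Preorder P'] {ℓ : P → A} {ℓ' : P' → A}
    {g : P → P'} {s : Set P'} (hg : StrictMono g) (hs : range g = s) (hℓ : ∀ p, ℓ' (g p) = ℓ p) :
    RankEquiv k ℓ (s.domRestrict ℓ') := by
  subst hs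
  exact .of_orderIso (hg.orderIso g) hℓ (by simp)

theorem RankEquiv.of_isOrderedCover {ι : Type*} [LinearOrder ι] [Preorder P] [Preorder P']
    {ℓ : P → A} {ℓ' : P' → A} {s : ι → Set P} {s' : ι → Set P'} (hs : IsOrderedCover s)
    (hs' : IsOrderedCover s') (h : ∀ i, RankEquiv k ((s i).domRestrict ℓ) ((s' i).domRestrict ℓ')) :
    RankEquiv k ℓ ℓ' :=
  BackForth.of_isOrderedCover hs hs' (by simp) h

variable [LinearOrder P] [LinearOrder P'] {ℓ : P → A} {ℓ' : P' → A}

theorem isOrderedCover_compl_of_isLowerSet {s : Set P} (hs : IsLowerSet s) :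
    IsOrderedCover fun b : Bool => cond b sᶜ s where
  exists_mem p := (em (p ∈ s)).elim (fun hp => ⟨false, hp⟩) fun hp => ⟨true, hp⟩
  lt_of_lt := by
    rintro (_ | _) (_ | _) p q hij hp hq
    exacts [absurd hij (lt_irrefl _), lt_of_not_ge fun hqp => hq (hs hqp hp),
      absurd hij (by decide), absurd hij (lt_irrefl _)]

theorem RankEquiv.of_isLowerSet {s : Set P} {s' : Set P'} (hs : IsLowerSet s) (hs' : IsLowerSet s')
    (h : RankEquiv k (s.domRestrict ℓ) (s'.domRestrict ℓ'))
    (h_compl : RankEquiv k (sᶜ.domRestrict ℓ) (s'ᶜ.domRestrict ℓ')) : RankEquiv k ℓ ℓ' :=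
  .of_isOrderedCover (isOrderedCover_compl_of_isLowerSet hs)
    (isOrderedCover_compl_of_isLowerSet hs') <| by rintro (_ | _) <;> assumption

theorem BackForth.rankEquiv_Ico {R : SetRel P P'} {a b : P} {a' b' : P'} (h : BackForth ℓ ℓ' k R)
    (ha : (a, a') ∈ R) (hb : (b, b') ∈ R) :
    RankEquiv k ((Ico a b).domRestrict ℓ) ((Ico a' b').domRestrict ℓ') := by
  refine (h.domRestrict fun p p' hp => ?_).mono (empty_subset _)
  have hpa : p < a ↔ p' < a' := hp.lt_iff_lt (mem_insert _ _) (mem_insert_of_mem _ ha)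
  have hpb : p < b ↔ p' < b' := hp.lt_iff_lt (mem_insert _ _) (mem_insert_of_mem _ hb)
  rw [mem_Ico, mem_Ico, ← not_lt, ← not_lt, hpa, hpb]

end RankEquiv

/-! ### Rank and first-order formulas -/

section Formulas

open FirstOrder Language

variable {A : Type u} {n : ℕ}

theorem range_snoc_pair {P P' : Type*} (x : Fin n → P) (x' : Fin n → P') (p : P) (p' : P') :
    range (fun i => ((Fin.snoc x p : Fin (n + 1) → P) i, (Fin.snoc x' p' : Fin (n + 1) → P') i)) =
      insert (p, p') (range fun i => (x i, x' i)) := by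
  ext a
  simp only [mem_range, mem_insert_iff, Fin.exists_fin_succ', Fin.snoc_castSucc, Fin.snoc_last]
  rw [or_comm, eq_comm (a := a)]

/-- The formula `φ` of `FO(<)`, whose free variables are numbered by `Fin n`, holds at the positions
`x` of the word with labelling `ℓ`. -/
def RealizeAt {P : Type} [LT P] (ℓ : P → A) (φ : (wordLang A).BoundedFormula Empty n)
    (x : Fin n → P) : Prop :=
  letI := wordStructure ℓ
  φ.Realize default x

theorem term_eq_var (t : (wordLang A).Term (Empty ⊕ Fin n)) : ∃ i, t = .var (Sum.inr i) := by
  match t with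
  | .var (.inr i) => exact ⟨i, rfl⟩

/-- The rank is the quantifier depth of `φ`. -/
theorem exists_backForth_realizeAt_iff (φ : (wordLang A).BoundedFormula Empty n) :
    ∃ k, ∀ (P P' : Type) [LinearOrder P] [LinearOrder P'] (ℓ : P → A) (ℓ' : P' → A)
      (x : Fin n → P) (x' : Fin n → P'), BackForth ℓ ℓ' k (range fun i => (x i, x' i)) →
      (RealizeAt ℓ φ x ↔ RealizeAt ℓ' φ x') := by
  induction φ with
  | falsum => exact ⟨0, fun P P' _ _ ℓ ℓ' x x' _ => Iff.rfl⟩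
  | equal t₁ t₂ =>
    refine ⟨0, fun P P' _ _ ℓ ℓ' x x' (h : IsPartialIso _ _ _) => ?_⟩
    obtain ⟨i, rfl⟩ := term_eq_var t₁
    obtain ⟨j, rfl⟩ := term_eq_var t₂
    change x i = x j ↔ x' i = x' j
    rw [eq_iff_le_not_lt, eq_iff_le_not_lt, ← not_lt, ← not_lt,
      h.lt_iff_lt (mem_range_self i) (mem_range_self j),
      h.lt_iff_lt (mem_range_self j) (mem_range_self i)]
  | rel r ts =>
    refine ⟨0, fun P P' _ _ ℓ ℓ' x x' (h : IsPartialIso _ _ _) => ?_⟩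
    cases r with
    | letter a =>
      obtain ⟨i, hi⟩ := term_eq_var (ts 0)
      simp [RealizeAt, BoundedFormula.Realize, Structure.RelMap, hi,
        h.label_eq (mem_range_self i)]
    | lt =>
      obtain ⟨i, hi⟩ := term_eq_var (ts 0)
      obtain ⟨j, hj⟩ := term_eq_var (ts 1)
      simp [RealizeAt, BoundedFormula.Realize, Structure.RelMap, hi, hj,
        h.lt_iff_lt (mem_range_self i) (mem_range_self j)]
  | imp φ ψ ihφ ihψ =>
    obtain ⟨k, hk⟩ := ihφ
    obtain ⟨m, hm⟩ := ihψ
    refine ⟨max k m, fun P P' _ _ ℓ ℓ' x x' h => ?_⟩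
    exact imp_congr (hk P P' ℓ ℓ' x x' (h.of_le (le_max_left _ _)))
      (hm P P' ℓ ℓ' x x' (h.of_le (le_max_right _ _)))
  | all φ ih =>
    obtain ⟨k, hk⟩ := ih
    refine ⟨k + 1, fun P P' _ _ ℓ ℓ' x x' h => ?_⟩
    have hk_snoc (p p') (hp : BackForth ℓ ℓ' k (insert (p, p') (range fun i => (x i, x' i)))) :
        RealizeAt ℓ φ (Fin.snoc x p) ↔ RealizeAt ℓ' φ (Fin.snoc x' p') :=
      hk P P' ℓ ℓ' _ _ (by rwa [range_snoc_pair])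
    change (∀ p, RealizeAt ℓ φ (Fin.snoc x p)) ↔ ∀ p', RealizeAt ℓ' φ (Fin.snoc x' p')
    constructor
    · intro hφ p'
      obtain ⟨p, hp⟩ := h.2.2 p'
      exact (hk_snoc _ _ hp).1 (hφ _)
    · intro hφ p
      obtain ⟨p', hp⟩ := h.2.1 p
      exact (hk_snoc _ _ hp).2 (hφ _)

/-- `φ` is a Hintikka formula of rank `k` of the positions `x` in the word with labelling `ℓ`: it
defines the equivalence class of rank `k` of `x`, among all tuples of positions in all words. -/
def IsHintikkaFormula {P : Type} [LT P] (k : ℕ) (ℓ : P → A) (x : Fin n → P)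
    (φ : (wordLang A).BoundedFormula Empty n) : Prop :=
  ∀ (P' : Type) [LT P'] (ℓ' : P' → A) (y : Fin n → P'),
    RealizeAt ℓ' φ y ↔ BackForth ℓ ℓ' k (range fun i => (x i, y i))

/-- The formula stating that `xᵢ` has label `c i`, and that `xᵢ < xⱼ` if and only if `r i j`. -/
noncomputable def atomicDiagram (c : Fin n → A) (r : Fin n → Fin n → Prop) :
    (wordLang A).BoundedFormula Empty n :=
  open Classical in
  let var (i : Fin n) : (wordLang A).Term (Empty ⊕ Fin n) := .var (Sum.inr i)
  let lt (i j : Fin n) : (wordLang A).BoundedFormula Empty n := .rel WordRel.lt ![var i, var j]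
  .iInf (fun i => .rel (WordRel.letter (c i)) ![var i]) ⊓
    .iInf fun ij : Fin n × Fin n => if r ij.1 ij.2 then lt ij.1 ij.2 else (lt ij.1 ij.2).not

theorem realizeAt_atomicDiagram {P : Type} [LT P] {ℓ : P → A} {c : Fin n → A}
    {r : Fin n → Fin n → Prop} {x : Fin n → P} :
    RealizeAt ℓ (atomicDiagram c r) x ↔
      (∀ i, ℓ (x i) = c i) ∧ ∀ i j, r i j ↔ x i < x j := by
  simp only [RealizeAt, atomicDiagram, BoundedFormula.realize_inf, BoundedFormula.realize_iInf,
    Prod.forall]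
  refine and_congr Iff.rfl (forall₂_congr fun i j => ?_)
  by_cases hij : r i j
  · simp only [hij, if_true, true_iff]
    exact Iff.rfl
  · simp only [hij, if_false, false_iff]
    exact Iff.rfl

theorem isHintikkaFormula_atomicDiagram {P : Type} [LT P] (ℓ : P → A) (x : Fin n → P) :
    IsHintikkaFormula 0 ℓ x (atomicDiagram (fun i => ℓ (x i)) fun i j => x i < x j) := by
  intro P' _ ℓ' x'
  rw [realizeAt_atomicDiagram]
  constructor
  · rintro ⟨hlabel, hlt⟩
    refine ⟨?_, ?_⟩
    · rintro _ _ ⟨i, ⟨⟩⟩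
      exact (hlabel i).symm
    · rintro _ _ _ _ ⟨i, ⟨⟩⟩ ⟨j, ⟨⟩⟩
      exact hlt i j
  · intro (h : IsPartialIso _ _ _)
    exact ⟨fun i => (h.label_eq (mem_range_self i)).symm,
      fun i j => h.lt_iff_lt (mem_range_self i) (mem_range_self j)⟩

/-- The formula stating that `φ` holds, that each `ψ j` is satisfied by some additional position,
and that each additional position satisfies some `ψ j`. -/
noncomputable def extensionFormula {κ : Type*} [Finite κ]
    (φ : (wordLang A).BoundedFormula Empty n) (ψ : κ → (wordLang A).BoundedFormula Empty (n + 1)) :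
    (wordLang A).BoundedFormula Empty n :=
  φ ⊓ (.iInf fun j => (ψ j).ex) ⊓ (BoundedFormula.iSup ψ).all

theorem realizeAt_extensionFormula {P : Type} [LT P] {ℓ : P → A} {x : Fin n → P} {κ : Type*}
    [Finite κ] {φ : (wordLang A).BoundedFormula Empty n}
    {ψ : κ → (wordLang A).BoundedFormula Empty (n + 1)} :
    RealizeAt ℓ (extensionFormula φ ψ) x ↔
      RealizeAt ℓ φ x ∧ (∀ j, ∃ p, RealizeAt ℓ (ψ j) (Fin.snoc x p)) ∧
        ∀ p, ∃ j, RealizeAt ℓ (ψ j) (Fin.snoc x p) := by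
  simp only [RealizeAt, extensionFormula, BoundedFormula.realize_inf, BoundedFormula.realize_iInf,
    BoundedFormula.realize_ex, BoundedFormula.realize_all, BoundedFormula.realize_iSup, and_assoc]

theorem IsHintikkaFormula.extensionFormula {P : Type} [LT P] {k : ℕ} {ℓ : P → A} {x : Fin n → P}
    {κ : Type*} [Finite κ] {φ : (wordLang A).BoundedFormula Empty n}
    {ψ : κ → (wordLang A).BoundedFormula Empty (n + 1)} (hφ : IsHintikkaFormula 0 ℓ x φ)
    (hψ : ∀ j, ∃ p, IsHintikkaFormula k ℓ (Fin.snoc x p) (ψ j))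
    (hψ' : ∀ p, ∃ j, IsHintikkaFormula k ℓ (Fin.snoc x p) (ψ j)) :
    IsHintikkaFormula (k + 1) ℓ x (extensionFormula φ ψ) := by
  intro P' _ ℓ' x'
  have realize_iff {j p} (hj : IsHintikkaFormula k ℓ (Fin.snoc x p) (ψ j)) (p' : P') :
      RealizeAt ℓ' (ψ j) (Fin.snoc x' p') ↔
        BackForth ℓ ℓ' k (insert (p, p') (range fun i => (x i, x' i))) := by
    rw [hj P' ℓ' (Fin.snoc x' p'), range_snoc_pair]
  rw [realizeAt_extensionFormula]
  refine and_congr (hφ P' ℓ' x') (and_congr ⟨fun h p => ?_, fun h j => ?_⟩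
    (forall_congr' fun p' => ⟨?_, ?_⟩))
  · obtain ⟨j, hj⟩ := hψ' p
    exact (h j).imp fun p' => (realize_iff hj p').1
  · obtain ⟨p, hj⟩ := hψ j
    exact (h p).imp fun p' => (realize_iff hj p').2
  · rintro ⟨j, hjp'⟩
    obtain ⟨p, hj⟩ := hψ j
    exact ⟨p, (realize_iff hj p').1 hjp'⟩
  · rintro ⟨p, hp⟩
    obtain ⟨j, hj⟩ := hψ' p
    exact ⟨j, (realize_iff hj p').2 hp⟩

theorem exists_finite_isHintikkaFormula (A : Type u) [Finite A] (k n : ℕ) :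
    ∃ Φ : Set ((wordLang A).BoundedFormula Empty n), Φ.Finite ∧
      ∀ (P : Type) [LT P] (ℓ : P → A) (x : Fin n → P), ∃ φ ∈ Φ, IsHintikkaFormula k ℓ x φ := by
  induction k generalizing n with
  | zero =>
    exact ⟨range fun cr : (Fin n → A) × (Fin n → Fin n → Prop) => atomicDiagram cr.1 cr.2,
      finite_range _,
      fun P _ ℓ x => ⟨_, mem_range_self (_, _), isHintikkaFormula_atomicDiagram ℓ x⟩⟩
  | succ k ih =>
    obtain ⟨Ψ, hΨ, hΨ_cover⟩ := ih (n + 1)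
    have : Finite Ψ := hΨ
    refine ⟨range fun a : ((Fin n → A) × (Fin n → Fin n → Prop)) × Set Ψ =>
      extensionFormula (atomicDiagram a.1.1 a.1.2) fun ψ : a.2 => ψ.1.1, finite_range _,
      fun P _ ℓ x => ?_⟩
    let Ψx : Set Ψ := {ψ | ∃ p, IsHintikkaFormula k ℓ (Fin.snoc x p) ψ.1}
    refine ⟨_, mem_range_self ((_, _), Ψx),
      (isHintikkaFormula_atomicDiagram ℓ x).extensionFormula (fun ψ => ψ.2) fun p => ?_⟩
    obtain ⟨ψ, hψ, hp⟩ := hΨ_cover P ℓ (Fin.snoc x p)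
    exact ⟨⟨⟨ψ, hψ⟩, p, hp⟩, hp⟩

end Formulas

/-! ### Optimal imprints and rank -/

section Imprint

variable {A : Type u} {X : Type v} {Y : Type w} {P : X → Type}

/-- The first-order definable subsets of the index set of a family `ℓ` of labelled orders. Finite
words and infinite words are the two families of interest. -/
def foClass [∀ x, LT (P x)] (ℓ : ∀ x, P x → A) : Set (Set X) :=
  {L | ∃ φ : (wordLang A).Sentence, L = {x | Satisfies (ℓ x) φ}}

/-- Equivalence of rank `k` between the members of a family of labelled orders. -/
def rankSetoid [∀ x, Preorder (P x)] (k : ℕ) (ℓ : ∀ x, P x → A) : Setoid X where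
  r x y := RankEquiv k (ℓ x) (ℓ y)
  iseqv := ⟨fun x => .refl k (ℓ x), .symm, .trans⟩

theorem exists_rankEquiv_mem_iff [∀ x, LinearOrder (P x)] {ℓ : ∀ x, P x → A} {L : Set X}
    (hL : L ∈ foClass ℓ) : ∃ k, ∀ x y, RankEquiv k (ℓ x) (ℓ y) → (x ∈ L ↔ y ∈ L) := by
  obtain ⟨φ, rfl⟩ := hL
  obtain ⟨k, hk⟩ := exists_backForth_realizeAt_iff φ
  exact ⟨k, fun x y h => hk _ _ (ℓ x) (ℓ y) default default (by rwa [range_eq_empty])⟩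

theorem IsHintikkaFormula.satisfies_iff {P P' : Type} [LT P] [LT P'] {k : ℕ} {ℓ : P → A}
    {ℓ' : P' → A} {φ : (wordLang A).Sentence} (hφ : IsHintikkaFormula k ℓ default φ) :
    Satisfies ℓ' φ ↔ RankEquiv k ℓ ℓ' := by
  have h := hφ P' ℓ' default
  rwa [range_eq_empty] at h

theorem mem_foClass_of_mem_classes [Finite A] [∀ x, Preorder (P x)] {k : ℕ} {ℓ : ∀ x, P x → A}
    {L : Set X} (hL : L ∈ (rankSetoid k ℓ).classes) : L ∈ foClass ℓ := by
  obtain ⟨x, rfl⟩ := hL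
  obtain ⟨_, -, hΦ⟩ := exists_finite_isHintikkaFormula A k 0
  obtain ⟨φ, -, hφ⟩ := hΦ (P x) (ℓ x) default
  refine ⟨φ, ext fun y => ?_⟩
  exact ⟨fun h => hφ.satisfies_iff.2 h.symm, fun h => (hφ.satisfies_iff.1 h).symm⟩

instance finite_quotient_rankSetoid [Finite A] [∀ x, Preorder (P x)] (k : ℕ) (ℓ : ∀ x, P x → A) :
    Finite (Quotient (rankSetoid k ℓ)) := by
  obtain ⟨Φ, hΦ, hΦ_cover⟩ := exists_finite_isHintikkaFormula A k 0
  choose φ hφ hφ_hintikka using fun x => hΦ_cover (P x) (ℓ x) default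
  have : Finite Φ := hΦ
  refine Finite.of_injective (fun q => (⟨φ q.out, hφ q.out⟩ : Φ)) fun q r hqr => ?_
  have hout : RankEquiv k (ℓ q.out) (ℓ r.out) := by
    rw [← (hφ_hintikka q.out).satisfies_iff, Subtype.mk.inj hqr, (hφ_hintikka r.out).satisfies_iff]
    exact .refl k (ℓ r.out)
  exact Quotient.out_equiv_out.1 hout

theorem isClassPartition_classes_rankSetoid [Finite A] [∀ x, Preorder (P x)] (k : ℕ)
    (ℓ : ∀ x, P x → A) : IsClassPartition (foClass ℓ) (rankSetoid k ℓ).classes :=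
  ⟨Finite.of_equiv _ (Setoid.quotientEquivClasses _), Setoid.isPartition_classes _,
    fun _ => mem_foClass_of_mem_classes⟩

theorem IsClassPartition.exists_rankEquiv_subset [∀ x, LinearOrder (P x)] {ℓ : ∀ x, P x → A}
    {K : Set (Set X)} (hK : IsClassPartition (foClass ℓ) K) :
    ∃ k, ∀ x, ∃ L ∈ K, {y | RankEquiv k (ℓ y) (ℓ x)} ⊆ L := by
  choose! rank hrank using fun L (hL : L ∈ K) => exists_rankEquiv_mem_iff (hK.2.2 hL)
  obtain ⟨k, hk⟩ := (hK.1.image rank).bddAbove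
  refine ⟨k, fun x => ?_⟩
  obtain ⟨L, ⟨hL, hx⟩, -⟩ := hK.2.1.2 x
  exact ⟨L, hL, fun y hy => (hrank L hL y x (hy.of_le (hk (mem_image_of_mem rank hL)))).2 hx⟩

theorem exists_subset_image_of_mem_optimalImprint [Finite A] [∀ x, Preorder (P x)]
    {ℓ : ∀ x, P x → A} {α : X → Y} {T : Set Y} (hT : T ∈ optimalImprint (foClass ℓ) α) (k : ℕ) :
    ∃ x, T ⊆ α '' {y | RankEquiv k (ℓ y) (ℓ x)} := by
  obtain ⟨K, hK, hTK⟩ := hT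
  obtain ⟨_, ⟨x, rfl⟩, hTx⟩ := hK.2 _ (isClassPartition_classes_rankSetoid k ℓ) hTK
  exact ⟨x, hTx⟩

theorem exists_image_mem_optimalImprint [∀ x, LinearOrder (P x)] {ℓ : ∀ x, P x → A} {α : X → Y}
    (hα : ∃ K, IsOptimal (foClass ℓ) α K) :
    ∃ k, ∀ x, α '' {y | RankEquiv k (ℓ y) (ℓ x)} ∈ optimalImprint (foClass ℓ) α := by
  obtain ⟨K, hK⟩ := hα
  obtain ⟨k, hk⟩ := hK.1.exists_rankEquiv_subset
  refine ⟨k, fun x => ?_⟩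
  obtain ⟨L, hL, hxL⟩ := hk x
  exact ⟨K, hK, L, hL, image_mono hxL⟩

theorem mem_optimalImprint_of_subset {C : Set (Set X)} {α : X → Y} {T T' : Set Y}
    (hT : T ∈ optimalImprint C α) (h : T' ⊆ T) : T' ∈ optimalImprint C α := by
  obtain ⟨K, hK, L, hL, hTL⟩ := hT
  exact ⟨K, hK, L, hL, h.trans hTL⟩

end Imprint

section WordImprint

variable {A : Type u} {Y : Type v}

/-- The equivalence class of rank `k` of the finite word `u`. -/
def wordClass (k : ℕ) (u : Word A) : Set (Word A) := {v | RankEquiv k (letterAt v) (letterAt u)}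

/-- The equivalence class of rank `k` of the infinite word `x`. -/
def omegaClass (k : ℕ) (x : OmegaWord A) : Set (OmegaWord A) := {y | RankEquiv k y x}

theorem exists_subset_image_wordClass [Finite A] {α : Word A → Y} {T : Set Y}
    (hT : T ∈ optimalImprint (foWord A) α) (k : ℕ) : ∃ u, T ⊆ α '' wordClass k u :=
  exists_subset_image_of_mem_optimalImprint (ℓ := fun w : Word A => letterAt w) hT k

theorem exists_image_wordClass_mem [Finite Y] (α : Word A → Y) :
    ∃ k, ∀ u, α '' wordClass k u ∈ optimalImprint (foWord A) α :=
  exists_image_mem_optimalImprint (ℓ := fun w : Word A => letterAt w) (exists_isOptimal_foWord α)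

theorem mem_optimalImprint_foOmega_iff [Finite A] [Finite Y] {α : OmegaWord A → Y} {T : Set Y} :
    T ∈ optimalImprint (foOmega A) α ↔ ∀ k, ∃ x, T ⊆ α '' omegaClass k x := by
  refine ⟨exists_subset_image_of_mem_optimalImprint (P := fun _ => ℕ)
    (ℓ := fun x : OmegaWord A => x), fun hT => ?_⟩
  obtain ⟨k, hk⟩ := exists_image_mem_optimalImprint (P := fun _ => ℕ)
    (ℓ := fun x : OmegaWord A => x) (exists_isOptimal_foOmega α)
  obtain ⟨x, hx⟩ := hT k
  exact mem_optimalImprint_of_subset (hk x) hx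

end WordImprint

/-! ### Products of words -/

section Products

variable {A : Type u} {k : ℕ}

theorem rankEquiv_Ico_of_letterAt_eq {x : OmegaWord A} {w : Word A} {a : ℕ}
    (h : ∀ q : Fin (letters w).length, x (a + q) = letterAt w q) :
    RankEquiv k (letterAt w) ((Ico a (a + (letters w).length)).domRestrict x) := by
  refine rankEquiv_domRestrict_of_range_eq (g := fun q : Fin (letters w).length => a + (q : ℕ))
    (fun _ _ hqr => Nat.add_lt_add_left hqr a) (ext fun p => ⟨?_, fun hp => ?_⟩) h
  · rintro ⟨q, rfl⟩
    exact ⟨Nat.le_add_right _ _, Nat.add_lt_add_left q.2 a⟩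
  · exact ⟨⟨p - a, Nat.sub_lt_left_of_lt_add hp.1 hp.2⟩, Nat.add_sub_cancel' hp.1⟩

theorem rankEquiv_letterAt_mul_left (u v : Word A) :
    RankEquiv k (letterAt u)
      ({p : Fin (letters (u * v)).length | p < (letters u).length}.domRestrict
        (letterAt (u * v))) := by
  have hlen : (letters u).length ≤ (letters (u * v)).length := by
    rw [letters_mul, List.length_append]
    exact Nat.le_add_right _ _
  exact rankEquiv_domRestrict_of_range_eq (Fin.strictMono_castLE hlen) (Fin.range_castLE hlen)
    fun q => List.getElem_append_left q.2

theorem rankEquiv_letterAt_mul_right (u v : Word A) :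
    RankEquiv k (letterAt v)
      ({p : Fin (letters (u * v)).length | p < (letters u).length}ᶜ.domRestrict
        (letterAt (u * v))) := by
  have hlen : (letters v).length + (letters u).length = (letters (u * v)).length := by
    rw [letters_mul, List.length_append, add_comm]
  refine rankEquiv_domRestrict_of_range_eq
    (g := fun q : Fin (letters v).length => (q.addNat (letters u).length).cast hlen)
    (fun _ _ hqr => Nat.add_lt_add_right hqr _) (ext fun p => ⟨?_, fun hp => ?_⟩)
    fun q => (List.getElem_append_right' (letters u) q.2).symm
  · rintro ⟨q, rfl⟩
    exact (Nat.le_add_left _ _).not_gt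
  · have hp : (letters u).length ≤ p := not_lt.1 hp
    exact ⟨⟨p - (letters u).length, by omega⟩, Fin.ext (Nat.sub_add_cancel hp)⟩

theorem RankEquiv.mul {u u' v v' : Word A} (hu : RankEquiv k (letterAt u) (letterAt u'))
    (hv : RankEquiv k (letterAt v) (letterAt v')) :
    RankEquiv k (letterAt (u * v)) (letterAt (u' * v')) := by
  have isLowerSet_left (u v : Word A) :
      IsLowerSet {p : Fin (letters (u * v)).length | p < (letters u).length} :=
    fun _ _ hqp hp => (Fin.le_def.1 hqp).trans_lt hp
  exact .of_isLowerSet (isLowerSet_left u v) (isLowerSet_left u' v')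
    (((rankEquiv_letterAt_mul_left u v).symm.trans hu).trans (rankEquiv_letterAt_mul_left u' v'))
    (((rankEquiv_letterAt_mul_right u v).symm.trans hv).trans (rankEquiv_letterAt_mul_right u' v'))

theorem rankEquiv_concat_left (u : Word A) (x : OmegaWord A) :
    RankEquiv k (letterAt u) ((Iio (letters u).length).domRestrict (concat u x)) := by
  refine rankEquiv_domRestrict_of_range_eq Fin.val_strictMono ?_ fun q => ?_
  · exact ext fun p => ⟨fun ⟨q, hq⟩ => hq ▸ q.2, fun hp => ⟨⟨p, hp⟩, rfl⟩⟩
  · simp [concat, letterAt]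

theorem rankEquiv_concat_right (u : Word A) (x : OmegaWord A) :
    RankEquiv k x ((Iio (letters u).length)ᶜ.domRestrict (concat u x)) := by
  refine rankEquiv_domRestrict_of_range_eq (g := ((letters u).length + ·))
    (fun _ _ hqr => Nat.add_lt_add_left hqr _) ?_ fun q => ?_
  · rw [compl_Iio]
    exact ext fun p => (exists_congr fun q => eq_comm).trans le_iff_exists_add.symm
  · simp [concat]

theorem RankEquiv.concat {u u' : Word A} {x x' : OmegaWord A}
    (hu : RankEquiv k (letterAt u) (letterAt u')) (hx : RankEquiv k x x') :
    RankEquiv k (concat u x) (concat u' x') :=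
  .of_isLowerSet (isLowerSet_Iio _) (isLowerSet_Iio _)
    (((rankEquiv_concat_left _ _).symm.trans hu).trans (rankEquiv_concat_left _ _))
    (((rankEquiv_concat_right _ _).symm.trans hx).trans (rankEquiv_concat_right _ _))

/-- The position of `infConcat f` at which the block `f n` starts. -/
def blockStart (f : ℕ → Word A) : ℕ → ℕ
  | 0 => 0
  | n + 1 => blockStart f n + (letters (f n)).length

theorem blockStart_strictMono (f : ℕ → Word A) : StrictMono (blockStart f) :=
  strictMono_nat_of_lt_succ fun n => Nat.lt_add_of_pos_right (letters_length_pos (f n))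

theorem blockStart_succ_eq_length (f : ℕ → Word A) (n : ℕ) :
    blockStart f (n + 1) = (letters (segProd f 0 n)).length := by
  induction n with
  | zero => exact Nat.zero_add _
  | succ n ih => rw [blockStart, ih, segProd, letters_mul, List.length_append, Nat.zero_add]

theorem infConcat_blockStart_add (f : ℕ → Word A) (n : ℕ) (q : Fin (letters (f n)).length) :
    infConcat f (blockStart f n + q) = letterAt (f n) q := by
  have hlt : blockStart f n + q < (letters (segProd f 0 n)).length := by
    rw [← blockStart_succ_eq_length]
    exact Nat.add_lt_add_left q.2 _
  rw [infConcat_eq f _ n hlt]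
  cases n with
  | zero => simp [blockStart, segProd, letterAt]
  | succ n =>
    simp only [blockStart_succ_eq_length, segProd, letters_mul, letterAt, List.getElem_append]
    simp

theorem isOrderedCover_Ico_succ {s : ℕ → ℕ} (hs : StrictMono s) (hs₀ : s 0 = 0) :
    IsOrderedCover fun n => Ico (s n) (s (n + 1)) where
  exists_mem p := by
    have hp : p ∈ Ici (s 0) := hs₀.trans_le p.zero_le
    have hcover : ⋃ n, Ico (s n) (s (n + 1)) = Ici (s 0) :=
      iUnion_Ico_map_succ_eq_Ici (fun _ => hs.monotone bot_le)
        hs.not_bddAbove_range_of_isSuccArchimedean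
    exact mem_iUnion.1 (hcover ▸ hp)
  lt_of_lt _ _ _ _ hij hp hq := hp.2.trans_le ((hs.monotone hij).trans hq.1)

theorem RankEquiv.infConcat {f f' : ℕ → Word A}
    (h : ∀ n, RankEquiv k (letterAt (f n)) (letterAt (f' n))) :
    RankEquiv k (infConcat f) (infConcat f') :=
  .of_isOrderedCover (isOrderedCover_Ico_succ (blockStart_strictMono f) rfl)
    (isOrderedCover_Ico_succ (blockStart_strictMono f') rfl) fun n =>
      ((rankEquiv_Ico_of_letterAt_eq (infConcat_blockStart_add f n)).symm.trans (h n)).trans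
        (rankEquiv_Ico_of_letterAt_eq (infConcat_blockStart_add f' n))

end Products

section Factors

variable {A : Type u} {k : ℕ}

/-- The factor of the infinite word `x` that consists of the letters at the positions `p` with
`a ≤ p < b`. It is a single letter when `b ≤ a`, since words are nonempty. -/
def factor (x : OmegaWord A) (a b : ℕ) : Word A :=
  segProd (fun n => FreeSemigroup.of (x n)) a (b - a - 1)

theorem letters_segProd_of (x : OmegaWord A) (a m : ℕ) :
    letters (segProd (fun n => FreeSemigroup.of (x n)) a m) =
      (List.range' a (m + 1)).map x := by
  induction m with
  | zero => rfl
  | succ m ih =>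
    rw [segProd, letters_mul, ih, List.range'_1_concat (n := m + 1), List.map_append]
    rfl

theorem letters_factor (x : OmegaWord A) {a b : ℕ} (hab : a < b) :
    letters (factor x a b) = (List.range' a (b - a)).map x := by
  rw [factor, letters_segProd_of, Nat.sub_add_cancel (Nat.sub_pos_of_lt hab)]

theorem rankEquiv_factor (x : OmegaWord A) {a b : ℕ} (hab : a < b) :
    RankEquiv k (letterAt (factor x a b)) ((Ico a b).domRestrict x) := by
  have hlen : b = a + (letters (factor x a b)).length := by
    rw [letters_factor x hab, List.length_map, List.length_range', Nat.add_sub_cancel' hab.le]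
  have h := rankEquiv_Ico_of_letterAt_eq (k := k) (x := x) (w := factor x a b) (a := a)
    fun q => by simp [letterAt, letters_factor x hab]
  rwa [← hlen] at h

theorem factor_mul_factor (x : OmegaWord A) {a b c : ℕ} (hab : a < b) (hbc : b < c) :
    factor x a b * factor x b c = factor x a c := by
  have h := segProd_mul (fun n => FreeSemigroup.of (x n)) a (b - a - 1) (c - b - 1)
  rwa [show a + (b - a - 1) + 1 = b by omega,
    show b - a - 1 + (c - b - 1) + 1 = c - a - 1 by omega] at h

theorem infConcat_of (x : OmegaWord A) : infConcat (fun n => FreeSemigroup.of (x n)) = x := by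
  funext p
  simp [infConcat, letters_segProd_of]

theorem infConcat_factor (x : OmegaWord A) {s : ℕ → ℕ} (hs : StrictMono s) (hs₀ : s 0 = 0) :
    infConcat (fun n => factor x (s n) (s (n + 1))) = x :=
  (OmegaSemigroup.infProd_blocks (T := OmegaWord A) (fun n => FreeSemigroup.of (x n)) s hs
    hs₀).trans (infConcat_of x)

theorem concat_factor_infConcat_factor (x : OmegaWord A) {t : ℕ → ℕ} (ht : StrictMono t)
    (ht₀ : 0 < t 0) :
    concat (factor x 0 (t 0)) (infConcat fun n => factor x (t n) (t (n + 1))) = x := by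
  have hs : StrictMono (seqCons 0 t) := strictMono_nat_of_lt_succ <| by
    rintro (_ | n)
    exacts [ht₀, ht n.lt_succ_self]
  calc concat (factor x 0 (t 0)) (infConcat fun n => factor x (t n) (t (n + 1)))
      = infConcat (seqCons (factor x 0 (t 0)) fun n => factor x (t n) (t (n + 1))) :=
        OmegaSemigroup.mixed_infProd (T := OmegaWord A) (factor x 0 (t 0)) _
    _ = infConcat fun n => factor x (seqCons 0 t n) (seqCons 0 t (n + 1)) := by
        congr 1
        funext n
        cases n <;> rfl
    _ = x := infConcat_factor x hs rfl

theorem BackForth.rankEquiv_factor {x x' : OmegaWord A} {R : SetRel ℕ ℕ} {a a' b b' : ℕ}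
    (h : BackForth x x' k R) (ha : (a, a') ∈ R) (hb : (b, b') ∈ R) (hab : a < b) :
    RankEquiv k (letterAt (factor x a b)) (letterAt (factor x' a' b')) :=
  ((FOImprint.rankEquiv_factor x hab).trans (h.rankEquiv_Ico ha hb)).trans
    (FOImprint.rankEquiv_factor x' ((h.isPartialIso.lt_iff_lt ha hb).1 hab)).symm

end Factors

/-! ### Recurrent positions -/

section Recurrence

variable {A : Type u} {k a a' c c' : ℕ} {v : Word A} {x y : OmegaWord A}

/-- The positions `a` and `c` of `x` merge: the factors from `a` and from `c` to some common end are
equivalent, and hence so are those to any later common end. -/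
def Merges (k : ℕ) (x : OmegaWord A) (a c : ℕ) : Prop :=
  ∃ d, a < d ∧ c < d ∧ RankEquiv k (letterAt (factor x a d)) (letterAt (factor x c d))

/-- Factors equivalent to `v` lead from `a` to arbitrarily late positions that merge with `a`. -/
def Recurs (k : ℕ) (v : Word A) (x : OmegaWord A) (a : ℕ) : Prop :=
  ∀ b, ∃ c, b < c ∧ a < c ∧ factor x a c ∈ wordClass k v ∧ Merges k x a c

theorem merges_refl (k : ℕ) (x : OmegaWord A) (a : ℕ) : Merges k x a a :=
  ⟨a + 1, a.lt_succ_self, a.lt_succ_self, .refl k _⟩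

/-- The argument behind Ramsey's theorem for the additive colouring of pairs `a < b` by the class of
`factor x a b`, with a nonprincipal ultrafilter choosing the limit colours. -/
theorem exists_recurs [Finite A] (k : ℕ) (x : OmegaWord A) : ∃ a v, 0 < a ∧ Recurs k v x a := by
  let color (a b : ℕ) : Quotient (rankSetoid k fun w : Word A => letterAt w) := ⟦factor x a b⟧
  have eventually_eq (f : ℕ → Quotient (rankSetoid k fun w : Word A => letterAt w)) :
      ∃ q, ∀ᶠ n in Filter.hyperfilter ℕ, f n = q :=
    Ultrafilter.eventually_exists_iff.1 (.of_forall fun n => ⟨f n, rfl⟩)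
  have eventually_gt (b : ℕ) : ∀ᶠ n in Filter.hyperfilter ℕ, b < n :=
    Nat.hyperfilter_le_atTop (Filter.eventually_gt_atTop b)
  choose limitColor hlimit using fun a => eventually_eq (color a)
  obtain ⟨q, hq⟩ := eventually_eq limitColor
  obtain ⟨a, ha_pos, haq⟩ := ((eventually_gt 0).and hq).exists
  refine ⟨a, q.out, ha_pos, fun b => ?_⟩
  obtain ⟨c, hbc, hac, hac_color, hcq⟩ :=
    ((eventually_gt b).and ((eventually_gt a).and ((hlimit a).and hq))).exists
  obtain ⟨d, hcd, had_color, hcd_color⟩ :=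
    ((eventually_gt c).and ((hlimit a).and (hlimit c))).exists
  have hac_class : color a c = ⟦q.out⟧ := by rw [hac_color, haq, Quotient.out_eq]
  have had_eq : color a d = color c d := by rw [had_color, hcd_color, haq, hcq]
  exact ⟨c, hbc, hac, Quotient.exact hac_class, d, hac.trans hcd, hcd, Quotient.exact had_eq⟩

theorem Recurs.exists_next (h : Recurs k v x a) (hc : Merges k x a c) :
    ∃ c', c < c' ∧ factor x c c' ∈ wordClass k v ∧ Merges k x a c' := by
  obtain ⟨d, had, hcd, hd⟩ := hc
  obtain ⟨c', hdc', -, hv, hc'⟩ := h d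
  have hac' : RankEquiv k (letterAt (factor x c c')) (letterAt (factor x a c')) := by
    rw [← factor_mul_factor x hcd hdc', ← factor_mul_factor x had hdc']
    exact hd.symm.mul (.refl k _)
  exact ⟨c', hcd.trans hdc', hac'.trans hv, hc'⟩

theorem Recurs.exists_strictMono (h : Recurs k v x a) :
    ∃ t : ℕ → ℕ, StrictMono t ∧ t 0 = a ∧ ∀ n, factor x (t n) (t (n + 1)) ∈ wordClass k v := by
  choose! next hlt hv hmerges using fun c (hc : Merges k x a c) => h.exists_next hc
  let t (n : ℕ) : ℕ := next^[n] a
  have t_succ (n : ℕ) : t (n + 1) = next (t n) := Function.iterate_succ_apply' _ _ _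
  have ht (n : ℕ) : Merges k x a (t n) := by
    induction n with
    | zero => exact merges_refl k x a
    | succ n ih => exact t_succ n ▸ hmerges _ ih
  exact ⟨t, strictMono_nat_of_lt_succ fun n => t_succ n ▸ hlt _ (ht n), rfl,
    fun n => t_succ n ▸ hv _ (ht n)⟩

theorem Recurs.mem_setMixed (h : Recurs k v x a) (ha : 0 < a) :
    x ∈ setMixed {factor x 0 a} (setInfPow (OmegaWord A) (wordClass k v)) := by
  obtain ⟨t, ht, rfl, hv⟩ := h.exists_strictMono
  exact ⟨_, rfl, _, ⟨_, hv, rfl⟩, (concat_factor_infConcat_factor x ht ha).symm⟩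

theorem BackForth.merges {R : SetRel ℕ ℕ} (h : BackForth x y (k + 1) R) (ha : (a, a') ∈ R)
    (hc : (c, c') ∈ R) (hac : Merges k x a c) : Merges k y a' c' := by
  obtain ⟨d, had, hcd, hd⟩ := hac
  obtain ⟨d', hd'⟩ := h.2.1 d
  have ha_insert := mem_insert_of_mem (d, d') ha
  have hc_insert := mem_insert_of_mem (d, d') hc
  have hd_insert := mem_insert (d, d') R
  exact ⟨d', (hd'.isPartialIso.lt_iff_lt ha_insert hd_insert).1 had,
    (hd'.isPartialIso.lt_iff_lt hc_insert hd_insert).1 hcd,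
    ((hd'.rankEquiv_factor ha_insert hd_insert had).symm.trans hd).trans
      (hd'.rankEquiv_factor hc_insert hd_insert hcd)⟩

theorem BackForth.recurs {R : SetRel ℕ ℕ} (h : BackForth x y (k + 3) R) (ha : (a, a') ∈ R)
    (hx : Recurs k v x a) : Recurs k v y a' := by
  intro b'
  obtain ⟨b, hb⟩ := h.2.2 b'
  obtain ⟨c, hbc, hac, hv, hmerges⟩ := hx b
  obtain ⟨c', hc⟩ := hb.2.1 c
  have ha_insert := mem_insert_of_mem (c, c') (mem_insert_of_mem (b, b') ha)
  have hb_insert := mem_insert_of_mem (c, c') (mem_insert (b, b') R)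
  have hc_insert := mem_insert (c, c') (insert (b, b') R)
  exact ⟨c', (hc.isPartialIso.lt_iff_lt hb_insert hc_insert).1 hbc,
    (hc.isPartialIso.lt_iff_lt ha_insert hc_insert).1 hac,
    ((hc.of_le k.le_succ).rankEquiv_factor ha_insert hc_insert hac).symm.trans hv,
    hc.merges ha_insert hc_insert hmerges⟩

theorem RankEquiv.exists_recurs (h : RankEquiv (k + 5) x y) (ha : 0 < a) (hx : Recurs k v x a) :
    ∃ a', 0 < a' ∧ factor y 0 a' ∈ wordClass k (factor x 0 a) ∧ Recurs k v y a' := by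
  obtain ⟨a', ha'⟩ := (BackForth.insert_bot h).2.1 a
  have h0_insert := mem_insert_of_mem (a, a') (mem_insert ((⊥ : ℕ), (⊥ : ℕ)) ∅)
  have ha_insert := mem_insert (a, a') (insert ((⊥ : ℕ), (⊥ : ℕ)) ∅)
  exact ⟨a', (ha'.isPartialIso.lt_iff_lt h0_insert ha_insert).1 ha,
    ((ha'.of_le (k.le_add_right 3)).rankEquiv_factor h0_insert ha_insert ha).symm,
    ha'.recurs ha_insert hx⟩

end Recurrence

/-! ### Saturation of the optimal imprint -/

section OmegaSemigroup

variable {S T S' T' : Type*} [Semigroup S] [OmegaSemigroup S T] [Semigroup S']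
  [OmegaSemigroup S' T']

theorem setMixed_mono {R R' : Set S} {U U' : Set T} (hR : R ⊆ R') (hU : U ⊆ U') :
    setMixed R U ⊆ setMixed R' U' := by
  rintro _ ⟨s, hs, x, hx, rfl⟩
  exact ⟨s, hR hs, x, hU hx, rfl⟩

theorem setInfPow_mono {R R' : Set S} (hR : R ⊆ R') : setInfPow T R ⊆ setInfPow T R' := by
  rintro _ ⟨f, hf, rfl⟩
  exact ⟨f, fun n => hR (hf n), rfl⟩

theorem OmegaHom.image_setMixed (α : OmegaHom S T S' T') (R : Set S) (U : Set T) :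
    α.inf '' setMixed R U = setMixed (α.fin '' R) (α.inf '' U) := by
  ext y
  constructor
  · rintro ⟨_, ⟨s, hs, x, hx, rfl⟩, rfl⟩
    exact ⟨_, mem_image_of_mem _ hs, _, mem_image_of_mem _ hx, α.map_mixed s x⟩
  · rintro ⟨_, ⟨s, hs, rfl⟩, _, ⟨x, hx, rfl⟩, rfl⟩
    exact ⟨_, ⟨s, hs, x, hx, rfl⟩, α.map_mixed s x⟩

theorem OmegaHom.image_setInfPow (α : OmegaHom S T S' T') (R : Set S) :
    α.inf '' setInfPow T R = setInfPow T' (α.fin '' R) := by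
  ext y
  constructor
  · rintro ⟨_, ⟨f, hf, rfl⟩, rfl⟩
    exact ⟨_, fun n => mem_image_of_mem _ (hf n), α.map_infProd f⟩
  · rintro ⟨g, hg, rfl⟩
    choose f hf hfg using hg
    exact ⟨_, ⟨f, hf, rfl⟩, (α.map_infProd f).trans (congrArg _ (funext hfg))⟩

end OmegaSemigroup

section Saturation

variable {A : Type u}

theorem setMixed_wordClass_subset (k : ℕ) (u : Word A) (x : OmegaWord A) :
    setMixed (wordClass k u) (omegaClass k x) ⊆ omegaClass k (concat u x) := by
  rintro _ ⟨u', hu, x', hx, rfl⟩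
  exact RankEquiv.concat hu hx

theorem setInfPow_wordClass_subset (k : ℕ) (u : Word A) :
    setInfPow (OmegaWord A) (wordClass k u) ⊆ omegaClass k (infConcat fun _ => u) := by
  rintro _ ⟨f, hf, rfl⟩
  exact RankEquiv.infConcat hf

theorem exists_omegaClass_subset_setMixed [Finite A] (k : ℕ) (x : OmegaWord A) :
    ∃ u v : Word A, omegaClass (k + 5) x ⊆
      setMixed (wordClass k u) (setInfPow (OmegaWord A) (wordClass k v)) := by
  obtain ⟨a, v, ha, hx⟩ := exists_recurs k x
  refine ⟨factor x 0 a, v, fun y hy => ?_⟩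
  obtain ⟨a', ha', hu, hy⟩ := RankEquiv.exists_recurs (RankEquiv.symm hy) ha hx
  exact setMixed_mono (singleton_subset_iff.2 hu) Subset.rfl (hy.mem_setMixed ha')

theorem isSaturated_optimalImprint [Finite A] {S : Type v} {T : Type w} [Semigroup S]
    [OmegaSemigroup S T] [Finite T] (α : OmegaHom (Word A) (OmegaWord A) S T) :
    IsSaturated (optimalImprint (foWord A) α.fin) (optimalImprint (foOmega A) α.inf) := by
  refine ⟨fun R hR => ?_, fun R hR U hU => ?_, fun U hU V => mem_optimalImprint_of_subset hU⟩
  · refine mem_optimalImprint_foOmega_iff.2 fun k => ?_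
    obtain ⟨u, hRu⟩ := exists_subset_image_wordClass hR k
    refine ⟨infConcat fun _ => u, (setInfPow_mono hRu).trans ?_⟩
    rw [← α.image_setInfPow]
    exact image_mono (setInfPow_wordClass_subset k u)
  · refine mem_optimalImprint_foOmega_iff.2 fun k => ?_
    obtain ⟨u, hRu⟩ := exists_subset_image_wordClass hR k
    obtain ⟨x, hUx⟩ := mem_optimalImprint_foOmega_iff.1 hU k
    refine ⟨concat u x, (setMixed_mono hRu hUx).trans ?_⟩
    rw [← α.image_setMixed]
    exact image_mono (setMixed_wordClass_subset k u x)

end Saturation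

end FOImprint

theorem mainTheorem6 {A : Type u} [Finite A] {S : Type v} {T : Type w} [Semigroup S]
    [FOImprint.OmegaSemigroup S T] [Finite S] [Finite T]
    (α : FOImprint.OmegaHom (FOImprint.Word A) (FOImprint.OmegaWord A) S T) :
    FOImprint.optimalImprint (FOImprint.foOmega A) α.inf =
      FOImprint.satInf T (FOImprint.optimalImprint (FOImprint.foWord A) α.fin) := by
  obtain ⟨⟨infPow_mem, mixed_mem, subset_mem⟩, satInf_subset⟩ := FOImprint.satInf_isLeast T
    (FOImprint.optimalImprint (FOImprint.foWord A) α.fin)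
  refine Set.Subset.antisymm (fun U hU => ?_)
    (satInf_subset (FOImprint.isSaturated_optimalImprint α))
  obtain ⟨k, hk⟩ := FOImprint.exists_image_wordClass_mem α.fin
  obtain ⟨x, hUx⟩ := FOImprint.mem_optimalImprint_foOmega_iff.1 hU (k + 5)
  obtain ⟨u, v, hxuv⟩ := FOImprint.exists_omegaClass_subset_setMixed k x
  refine subset_mem _ (mixed_mem _ (hk u) _ (infPow_mem _ (hk v))) U ?_
  rw [← α.image_setInfPow, ← α.image_setMixed]
  exact hUx.trans (Set.image_mono hxuv)
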